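/- **Conventions.** Let $\mathcal P_f(\mathbb N)$ be the set of non-empty finite subsets of $\mathbb N$; for $\alpha,\beta\in\mathcal P_f(\mathbb N)$ write $\alpha<\beta$ if $\max\alpha<\min\beta$. Let $\mathbb E$ be the family of all $S\subset\mathcal P_f(\mathbb N)$ such that, for some $\beta$, $S$ contains every $\alpha>\beta$; an identity of mappings holds $\mathbb E$-a.e. if the set where it holds is in $\mathbb E$. Let $G$ be a group, write $u^c=c^{-1}uc$ and $[u,c]=u^{-1}c^{-1}uc$ (pointwise for mappings into $G$), and let $1$ also denote the constant mapping $\alpha\mapsto 1$. *Polynomial mappings.* A mapping $x:\mathcal P_f(\mathbb N)\to G$ is an IP mapping if $x(\alpha\cup\beta)=x(\alpha)x(\beta)$ whenever $\alpha<\beta$. Put $D_\beta x(\alpha)=x(\alpha)^{-1}x(\alpha\cup\beta)x(\beta)^{-1}$. A mapping $P:\mathcal P_f(\mathbb N)\to G$ is polynomial of degree $1$ if it is $\mathbb E$-a.e. equal to an IP mapping, and polynomial of degree $d>1$ if $\{\beta: D_\beta P\text{ is polynomial of degree }d-1\}\in\mathbb E$. It is a polynomial mapping if it is polynomial of some degree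 $d\ge 1$. *Filters.* A filter $\mathcal F$ on $G$ (with $\emptyset\notin\mathcal F$) is idempotent if $\{x:\{y: xy\in A\}\in\mathcal F\}\in\mathcal F$ for every $A\in\mathcal F$. The set $\beta G$ of ultrafilters on $G$ is a semigroup under $A\in p\cdot q\iff\{x:\{y:xy\in A\}\in q\}\in p$; for an idempotent filter $\mathcal F$, the set $\overline{\mathcal F}$ of ultrafilters extending $\mathcal F$ is a compact subsemigroup of $\beta G$, and $K(\overline{\mathcal F})$ denotes its smallest two-sided ideal. A set $A\subset G$ is piecewise $\mathcal F$-syndetic if $A\in p$ for some $p\in K(\overline{\mathcal F})$. A mapping $x:\mathcal P_f(\mathbb N)\to G$ is $\mathcal F$-measurable if $x^{-1}(V\cup\{1\})\in\mathbb E$ for all $V\in\mathcal F$. *Good collections.* A set $\mathbf P$ of polynomial mappings into $G$ is a good collection of $\mathcal F$-measurable polynomial mappings if (I) $1\in\mathbf P$; (II) every $P\in\mathbf P$ is $\mathcal F$-measurable; (III) for all $R,P\in\mathbf P$, $\{c\in G: R^c[c,P]\in\mathbf P\}\in\mathcal F$; (IV) for all $R,P\in\mathbf P$ there are $C\in\mathcal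 F$ and $\mathcal T\in\mathbb E$ such that $(R\,D_\beta P)^c\in\mathbf P$ for all $c\in C$ and $\beta\in\mathcal T$. A finite set $\mathscr A$ of polynomial mappings is a $\mathbf P$-minimal system with $\mathbf P$-minimal element $P_{\min}$ if $P_{\min}\in\mathscr A$ and $PP_{\min}^{-1}\in\mathbf P$ for all $P\in\mathscr A$. **Theorem.** Let $\mathbf P$ be a good collection of $\mathcal F$-measurable polynomial mappings for an idempotent filter $\mathcal F$ on a nilpotent group $G$. Let $\mathscr A$ be a $\mathbf P$-minimal system with $\mathbf P$-minimal element $P_{\min}$, partitioned into three classes $\mathscr A=\mathscr A^-\cup\{1\}\cup\mathscr A^+$ (where $\mathscr A^-$ and $\mathscr A^+$ may be empty). Then for all $\beta\in\mathcal P_f(\mathbb N)$, all $V\in\mathcal F$ and all piecewise $\mathcal F$-syndetic sets $A\subset G$ there exist $\alpha\in\mathcal P_f(\mathbb N)$ with $\alpha>\beta$ and $v\in V$ such that $$P(\alpha)v\in V\quad\text{for all }P\in\mathscr A^-,\qquad P(\alpha)v\in A\quad\text{for all }P\in\{1\}\cup\mathscr A^+.$$ -/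

import Mathlib

open Filter

namespace NilpotentPHJ

/-- The non-empty finite subsets of `ℕ`. -/
abbrev FinSets : Type := {s : Finset ℕ // s.Nonempty}

namespace FinSets

/-- `α < β`, i.e. `max α < min β`: every element of `α` is below every element of `β`. -/
def Before (α β : FinSets) : Prop := ∀ a ∈ α.1, ∀ b ∈ β.1, a < b

/-- The union of two non-empty finite sets. -/
def union (α β : FinSets) : FinSets := ⟨α.1 ∪ β.1, α.2.mono Finset.subset_union_left⟩

theorem Before.of_union_left {α β γ : FinSets} (h : (union α β).Before γ) : α.Before γ :=
  fun a ha c hc => h a (Finset.mem_union_left _ ha) c hc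

theorem Before.of_union_right {α β γ : FinSets} (h : (union α β).Before γ) : β.Before γ :=
  fun b hb c hc => h b (Finset.mem_union_right _ hb) c hc

end FinSets

/-- The filter `𝔼` on the non-empty finite subsets of `ℕ`: a set `V` belongs to it iff
there is `β` such that `V` contains all `α > β`. -/
def EE : Filter FinSets where
  sets := {V | ∃ β : FinSets, {α : FinSets | β.Before α} ⊆ V}
  univ_sets := ⟨⟨{0}, Finset.singleton_nonempty 0⟩, Set.subset_univ _⟩
  sets_of_superset := fun ⟨β, hβ⟩ h => ⟨β, hβ.trans h⟩
  inter_sets := fun ⟨β, hβ⟩ ⟨γ, hγ⟩ =>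
    ⟨FinSets.union β γ, fun _ hα =>
      ⟨hβ (FinSets.Before.of_union_left hα), hγ (FinSets.Before.of_union_right hα)⟩⟩

theorem mem_EE {V : Set FinSets} :
    V ∈ EE ↔ ∃ β : FinSets, ∀ α : FinSets, β.Before α → α ∈ V := Iff.rfl

section Maps

variable {G : Type*} [Group G]

/-- IP mappings. -/
def IsIPMap (x : FinSets → G) : Prop :=
  ∀ α β : FinSets, α.Before β → x (α.union β) = x α * x β

/-- The discrete derivative `D_β x (α) = x(α)⁻¹ x(α ∪ β) x(β)⁻¹`. -/
def discDeriv (β : FinSets) (x : FinSets → G) : FinSets → G :=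
  fun α => (x α)⁻¹ * x (α.union β) * (x β)⁻¹

/-- Polynomial mappings of degree `d`, for `d ≥ 1` (no mapping has degree `0`): degree `1` means
`𝔼`-a.e. equal to an IP mapping; degree `d + 1` with `d ≥ 1` means that for `𝔼`-almost every `β`
the derivative in direction `β` is of degree `d`. -/
def IsPolyOfDegree : ℕ → (FinSets → G) → Prop
  | 0, _ => False
  | 1, P => ∃ x : FinSets → G, IsIPMap x ∧ P =ᶠ[EE] x
  | d + 2, P => {β : FinSets | IsPolyOfDegree (d + 1) (discDeriv β P)} ∈ EE

/-- Polynomial mappings (of some degree `d ≥ 1`). -/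
def IsPolyMap (P : FinSets → G) : Prop := ∃ d : ℕ, 1 ≤ d ∧ IsPolyOfDegree d P

/-- The conjugate `x^c = c⁻¹ x c`, taken pointwise. -/
def conjMap (x : FinSets → G) (c : G) : FinSets → G := fun α => c⁻¹ * x α * c

/-- The mapping `[c, P]`, where `[u, v] = u⁻¹ v⁻¹ u v`. -/
def commMap (c : G) (P : FinSets → G) : FinSets → G := fun α => c⁻¹ * (P α)⁻¹ * c * P α

end Maps

section Filters

variable {G : Type*} [Group G]

/-- The product of two filters on `G`; see `mem_filterProd` for its members. -/
def filterProd (F H : Filter G) : Filter G := F.bind fun x => H.map fun y => x * y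

theorem mem_filterProd {F H : Filter G} {A : Set G} :
    A ∈ filterProd F H ↔ {x : G | {y : G | x * y ∈ A} ∈ H} ∈ F := by
  rw [filterProd, Filter.mem_bind']
  rfl

/-- A filter is idempotent if, as a family of sets, it is contained in its square.
(In Mathlib's order on filters, `H ≤ F` means that every member of `F` is a member of `H`.) -/
def IsIdempotentFilter (F : Filter G) : Prop := filterProd F F ≤ F

theorem isIdempotentFilter_iff {F : Filter G} :
    IsIdempotentFilter F ↔ ∀ A ∈ F, {x : G | {y : G | x * y ∈ A} ∈ F} ∈ F :=
  ⟨fun h _ hA => mem_filterProd.1 (h hA), fun h A hA => mem_filterProd.2 (h A hA)⟩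

/-- Multiplication of ultrafilters on `G`. -/
def ultraMul (p q : Ultrafilter G) : Ultrafilter G := (Ultrafilter.mul (M := G)).mul p q

theorem mem_ultraMul {p q : Ultrafilter G} {A : Set G} :
    A ∈ ultraMul p q ↔ {x : G | {y : G | x * y ∈ A} ∈ q} ∈ p := Iff.rfl

/-- The closure of the filter `F`: the set of all ultrafilters that extend `F`. -/
def filterClosure (F : Filter G) : Set (Ultrafilter G) := {p | ∀ A ∈ F, A ∈ p}

/-- `I` is a two-sided ideal of `T ⊆ βG`. -/
structure IsTwoSidedIdeal (T I : Set (Ultrafilter G)) : Prop where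
  nonempty : I.Nonempty
  subset : I ⊆ T
  mul_left : ∀ t ∈ T, ∀ p ∈ I, ultraMul t p ∈ I
  mul_right : ∀ t ∈ T, ∀ p ∈ I, ultraMul p t ∈ I

/-- The smallest two-sided ideal `K(T)` of `T`: the intersection of all two-sided ideals of `T`. -/
def smallestIdeal (T : Set (Ultrafilter G)) : Set (Ultrafilter G) :=
  {p | ∀ I : Set (Ultrafilter G), IsTwoSidedIdeal T I → p ∈ I}

/-- `A` is piecewise `F`-syndetic if some `p ∈ K(T)` contains `A`, where `T` is the closure
of `F`. -/
def IsPiecewiseSyndetic (F : Filter G) (A : Set G) : Prop :=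
  ∃ p ∈ smallestIdeal (filterClosure F), A ∈ p

/-- `x` is `F`-measurable if the preimage of `V ∪ {1}` belongs to `𝔼` for every `V ∈ F`. -/
def IsFMeasurable (F : Filter G) (x : FinSets → G) : Prop :=
  ∀ V ∈ F, x ⁻¹' (V ∪ {1}) ∈ EE

/-- Good collections of `F`-measurable polynomial mappings. -/
structure IsGoodCollection (F : Filter G) (PP : Set (FinSets → G)) : Prop where
  poly : ∀ P ∈ PP, IsPolyMap P
  one_mem : (1 : FinSets → G) ∈ PP
  measurable : ∀ P ∈ PP, IsFMeasurable F P
  conj_mem : ∀ R ∈ PP, ∀ P ∈ PP, {c : G | conjMap R c * commMap c P ∈ PP} ∈ F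
  deriv_mem : ∀ R ∈ PP, ∀ P ∈ PP, ∃ C ∈ F, ∃ S ∈ EE,
    ∀ c ∈ C, ∀ β ∈ S, conjMap (R * discDeriv β P) c ∈ PP

/-- A system is a finite collection of polynomial mappings. -/
def IsSystem (𝒜 : Set (FinSets → G)) : Prop := 𝒜.Finite ∧ ∀ P ∈ 𝒜, IsPolyMap P

/-- `𝒜` is a `PP`-minimal system with `PP`-minimal element `Pmin`. -/
structure IsMinimalSystem (PP 𝒜 : Set (FinSets → G)) (Pmin : FinSets → G) : Prop where
  system : IsSystem 𝒜
  min_mem : Pmin ∈ 𝒜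
  mul_inv_mem : ∀ P ∈ 𝒜, P * Pmin⁻¹ ∈ PP

/-- `𝒜` is partitioned into the three (possibly empty, apart from `{1}`) classes
`𝒜⁻`, `{1}` and `𝒜⁺`. -/
structure IsPartition (𝒜 𝒜neg 𝒜pos : Set (FinSets → G)) : Prop where
  union_eq : 𝒜 = 𝒜neg ∪ {1} ∪ 𝒜pos
  disjoint : Disjoint 𝒜neg 𝒜pos
  one_notMem_neg : (1 : FinSets → G) ∉ 𝒜neg
  one_notMem_pos : (1 : FinSets → G) ∉ 𝒜pos

end Filters

end NilpotentPHJ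

open NilpotentPHJ

/-! Let `A` belong to `p` in the smallest ideal. Then `p = p * e` for a minimal idempotent `e`, so
some `x` in a core of `V` has `x⁻¹A ∈ e`. The substitution `v = x Pmin(α)⁻¹ w` turns `P(α) v` into
`x · P^x(α) Pmin(α)⁻¹ · w`. It therefore suffices to prove recurrence into members of `e` for
finitely many maps `Q * S` with `S = Pmin⁻¹` and `Q = P^x`, while finitely many maps of `PP` stay in
members of `F`; this is `Recurs`.

Two arguments interlock. Colour focusing (`exists_focused`, `recurs_of_perturbations`): minimality
of `e` and compactness cover a member of `F` by finitely many translates `x⁻¹ (returnSet e A)`, the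
colours. Each new colour opens a thread, and all threads are moved at once until a colour repeats.
Moving them needs recurrence only for maps obtained from the `Q` by conjugation and differentiation.

PET induction (`recurs_of_leading`): nilpotency gives a chain of groups of maps (`exists_petChain`)
in which conjugation by constants and differentiation act trivially modulo the preceding term. The
perturbed maps thus keep their leading terms. Absorbing one map of lowest level into the base `S`
cancels a leading term at the cost of terms of lower level, so the multiset of levels descends. -/

namespace NilpotentPHJ

/-! ### Commutators in the lower central series. -/

section LowerCentral

open Subgroup

variable {G : Type*} [Group G]

/-- The three subgroups lemma, relative to a normal subgroup. -/
theorem commutator_commutator_le_of_rotate {A B C N : Subgroup G} [N.Normal]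
    (h1 : ⁅⁅B, C⁆, A⁆ ≤ N) (h2 : ⁅⁅C, A⁆, B⁆ ≤ N) : ⁅⁅A, B⁆, C⁆ ≤ N := by
  have key : ∀ H : Subgroup G, H ≤ N ↔ H.map (QuotientGroup.mk' N) = ⊥ := by
    intro H
    rw [Subgroup.map_eq_bot_iff, QuotientGroup.ker_mk']
  rw [key] at h1 h2 ⊢
  simp only [map_commutator] at h1 h2 ⊢
  exact commutator_commutator_eq_bot_of_rotate h1 h2

/-- Induction on `j` by the three subgroups lemma. Indexing from `0` accounts for the extra `+ 1`.
-/
theorem lowerCentralSeries_commutator_le (i j : ℕ) :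
    ⁅Subgroup.lowerCentralSeries (⊤ : Subgroup G) i, Subgroup.lowerCentralSeries (⊤ : Subgroup G) j⁆ ≤
      Subgroup.lowerCentralSeries (⊤ : Subgroup G) (i + j + 1) := by
  induction j generalizing i with
  | zero => exact le_of_eq rfl
  | succ j ih =>
    rw [Subgroup.lowerCentralSeries_succ ⊤ j, commutator_comm]
    apply commutator_commutator_le_of_rotate
    · rw [commutator_comm ⊤, ← Subgroup.lowerCentralSeries_succ]
      refine (ih (i + 1)).trans (le_of_eq ?_)
      congr 1
      ring
    · refine (commutator_mono (ih i) le_rfl).trans (le_of_eq ?_)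
      rw [← Subgroup.lowerCentralSeries_succ]
      congr 1

end LowerCentral

/-! ### Polynomial mappings measured against a filtration. -/

section Filtered

variable {G : Type*} [Group G]

theorem eventually_EE_union {p : FinSets → Prop} (h : ∀ᶠ α in EE, p α) :
    ∀ᶠ β in EE, ∀ᶠ α in EE, p (FinSets.union α β) := by
  obtain ⟨γ, hγ⟩ := mem_EE.1 h
  refine mem_EE.2 ⟨γ, fun β hβ => mem_EE.2 ⟨γ, fun α hα => hγ _ ?_⟩⟩
  intro a ha b hb
  rcases Finset.mem_union.1 hb with hb | hb
  · exact hα a ha b hb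
  · exact hβ a ha b hb

theorem eventually_EE_before (β : FinSets) : ∀ᶠ α in EE, β.Before α :=
  mem_EE.2 ⟨β, fun _ h => h⟩

instance : EE.NeBot := by
  refine ⟨fun h => ?_⟩
  obtain ⟨β, hβ⟩ := mem_EE.1 (h ▸ mem_bot : (∅ : Set FinSets) ∈ EE)
  refine hβ ⟨{β.1.sup id + 1}, Finset.singleton_nonempty _⟩ ?_
  intro a ha b hb
  rw [Finset.mem_singleton] at hb
  have : a ≤ β.1.sup id := Finset.le_sup (f := id) ha
  omega

/-- A descending sequence of subgroups with `⁅Γ i, Γ j⁆ ≤ Γ (i + j)` that starts with the whole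
group twice. -/
structure IsFiltration (Γ : ℕ → Subgroup G) : Prop where
  zero : Γ 0 = ⊤
  one : Γ 1 = ⊤
  anti : Antitone Γ
  comm : ∀ i j, ⁅Γ i, Γ j⁆ ≤ Γ (i + j)

/-- Maps of level `k` with respect to `Γ`, tested on at most `n` iterated derivatives. -/
def IsLevel (Γ : ℕ → Subgroup G) : ℕ → ℕ → (FinSets → G) → Prop
  | 0, k, Q => ∀ᶠ α in EE, Q α ∈ Γ (k + 1)
  | n + 1, k, Q => (∀ᶠ α in EE, Q α ∈ Γ (k + 1)) ∧
      ∀ᶠ β in EE, IsLevel Γ n (k + 1) (discDeriv β Q)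

/-- The commutator `a⁻¹ b⁻¹ a b`. -/
def comm' {K : Type*} [Group K] (a b : K) : K := a⁻¹ * b⁻¹ * a * b

/-- The constant map. -/
abbrev cst (c : G) : FinSets → G := fun _ => c

variable {Γ : ℕ → Subgroup G}

theorem IsLevel.mem {n k : ℕ} {Q : FinSets → G} (h : IsLevel Γ n k Q) :
    ∀ᶠ α in EE, Q α ∈ Γ (k + 1) := by
  cases n with
  | zero => exact h
  | succ n => exact h.1

theorem IsLevel.congr {n k : ℕ} {P Q : FinSets → G} (hPQ : P =ᶠ[EE] Q) (h : IsLevel Γ n k P) :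
    IsLevel Γ n k Q := by
  induction n generalizing k P Q with
  | zero => filter_upwards [hPQ, h] with α h1 h2; rwa [← h1]
  | succ n ih =>
    refine ⟨?_, ?_⟩
    · filter_upwards [hPQ, h.1] with α h1 h2; rwa [← h1]
    · filter_upwards [h.2, eventually_EE_union hPQ, hPQ] with β h1 h2 h3
      refine ih ?_ h1
      filter_upwards [h2, hPQ] with α h4 h5
      simp only [discDeriv, h3, h4, h5]

theorem IsLevel.of_succ {n k : ℕ} {Q : FinSets → G} (h : IsLevel Γ (n + 1) k Q) :
    IsLevel Γ n k Q := by
  induction n generalizing k Q with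
  | zero => exact h.1
  | succ n ih =>
    refine ⟨h.1, ?_⟩
    filter_upwards [h.2] with β hβ using ih hβ

theorem IsLevel.anti (hΓ : IsFiltration Γ) {n k l : ℕ} (hkl : k ≤ l) {Q : FinSets → G}
    (h : IsLevel Γ n l Q) : IsLevel Γ n k Q := by
  induction n generalizing k l Q with
  | zero => filter_upwards [h] with α hα using hΓ.anti (by omega) hα
  | succ n ih =>
    refine ⟨?_, ?_⟩
    · filter_upwards [h.1] with α hα using hΓ.anti (by omega) hα
    · filter_upwards [h.2] with β hβ using ih (by omega) hβ

theorem IsFiltration.comm_mem (hΓ : IsFiltration Γ) {i j : ℕ} {a b : G} (ha : a ∈ Γ i)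
    (hb : b ∈ Γ j) : comm' a b ∈ Γ (i + j) := by
  have := hΓ.comm i j (Subgroup.commutator_mem_commutator (inv_mem ha) (inv_mem hb))
  simpa [commutatorElement_def, comm'] using this

/-- The maps of level `k`, tested on `n` derivatives, form groups that behave well under
commutators. -/
structure LevelGroups (Γ : ℕ → Subgroup G) (n : ℕ) : Prop where
  mul : ∀ {k P Q}, IsLevel Γ n k P → IsLevel Γ n k Q → IsLevel Γ n k (P * Q)
  inv : ∀ {k P}, IsLevel Γ n k P → IsLevel Γ n k P⁻¹
  comm_cst : ∀ {i j Q c}, IsLevel Γ n i Q → c ∈ Γ j → IsLevel Γ n (i + j) (comm' Q (cst c))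
  comm : ∀ {i j P Q}, IsLevel Γ n i P → IsLevel Γ n j Q → IsLevel Γ n (i + j) (comm' P Q)

theorem LevelGroups.conj_cst (h : LevelGroups Γ n) (hΓ : IsFiltration Γ) {k : ℕ}
    {Q : FinSets → G} (hQ : IsLevel Γ n k Q) (c : G) :
    IsLevel Γ n k ((cst c)⁻¹ * Q * cst c) := by
  have : (cst c)⁻¹ * Q * cst c = Q * comm' Q (cst c) := by simp only [comm']; group
  rw [this]
  exact h.mul hQ (h.comm_cst (j := 0) hQ (by rw [hΓ.zero]; trivial))

theorem LevelGroups.conj (h : LevelGroups Γ n) (hΓ : IsFiltration Γ) {i k : ℕ}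
    {P Q : FinSets → G} (hQ : IsLevel Γ n k Q) (hP : IsLevel Γ n i P) :
    IsLevel Γ n k (P⁻¹ * Q * P) := by
  have : P⁻¹ * Q * P = Q * comm' Q P := by simp only [comm']; group
  rw [this]
  exact h.mul hQ ((h.comm hQ hP).anti hΓ (by omega))

theorem LevelGroups.cst_comm (h : LevelGroups Γ n) {i j : ℕ} {Q : FinSets → G} {c : G}
    (hQ : IsLevel Γ n i Q) (hc : c ∈ Γ j) : IsLevel Γ n (i + j) (comm' (cst c) Q) := by
  have : comm' (cst c) Q = (comm' Q (cst c))⁻¹ := by simp only [comm']; group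
  rw [this]
  exact h.inv (h.comm_cst hQ hc)

theorem discDeriv_mul_eq (P Q : FinSets → G) (β : FinSets) :
    discDeriv β (P * Q) = (Q⁻¹ * discDeriv β P * Q) * comm' Q (cst (P β)⁻¹) *
      ((cst (P β)⁻¹)⁻¹ * discDeriv β Q * cst (P β)⁻¹) := by
  funext α
  simp only [discDeriv, comm', Pi.mul_apply, Pi.inv_apply]
  group

theorem discDeriv_inv_eq (P : FinSets → G) (β : FinSets) :
    discDeriv β P⁻¹ = comm' P⁻¹ (cst (P β)) *
      ((cst (P β))⁻¹ * ((P⁻¹)⁻¹ * (discDeriv β P)⁻¹ * P⁻¹) * cst (P β)) := by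
  funext α
  simp only [discDeriv, comm', Pi.mul_apply, Pi.inv_apply]
  group

theorem discDeriv_comm_cst_eq (Q : FinSets → G) (c : G) (β : FinSets) :
    discDeriv β (comm' Q (cst c)) =
      comm' (comm' Q (cst c)) (discDeriv β Q) * comm' (discDeriv β Q) (cst c) *
        comm' (comm' (Q * discDeriv β Q) (cst c)) (cst (Q β)) := by
  funext α
  simp only [discDeriv, comm', Pi.mul_apply, Pi.inv_apply]
  group

/-- Every factor is, up to conjugation, a commutator containing a derivative or a constant besides
the data of `[P, Q]`, so each gains one level. -/
theorem discDeriv_comm_eq (P Q : FinSets → G) (β : FinSets) :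
    discDeriv β (comm' P Q) =
      ((comm' P Q)⁻¹ * ((cst (P β))⁻¹ * comm' (P * discDeriv β P) (cst (Q β)) * cst (P β)) *
        comm' P Q) *
      ((comm' P Q)⁻¹ * ((discDeriv β P)⁻¹ * comm' P (discDeriv β Q) * discDeriv β P) *
        comm' P Q) *
      comm' (comm' P Q) (discDeriv β Q * discDeriv β P) *
      comm' (discDeriv β P) (Q * discDeriv β Q) *
      comm' (comm' (P * discDeriv β P) (Q * discDeriv β Q)) (cst (Q β * P β)) *
      ((cst (comm' (P β) (Q β))⁻¹)⁻¹ *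
        ((cst (Q β))⁻¹ * comm' (cst (P β)) (Q * discDeriv β Q) * cst (Q β)) *
        cst (comm' (P β) (Q β))⁻¹) := by
  funext α
  simp only [discDeriv, comm', Pi.mul_apply, Pi.inv_apply]
  group

/-- All four closure properties go through one induction, since the derivative of each operation
involves the others with one test fewer. `Γ 1 = ⊤` makes a commutator with any constant gain a
level. -/
theorem levelGroups (hΓ : IsFiltration Γ) (n : ℕ) : LevelGroups Γ n := by
  induction n with
  | zero =>
    refine ⟨?_, ?_, ?_, ?_⟩
    · intro k P Q hP hQ
      filter_upwards [hP, hQ] with α h1 h2 using mul_mem h1 h2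
    · intro k P hP
      filter_upwards [hP] with α h1 using inv_mem h1
    · intro i j Q c hQ hc
      filter_upwards [hQ] with α h1
      exact hΓ.anti (by omega) (hΓ.comm_mem h1 hc)
    · intro i j P Q hP hQ
      filter_upwards [hP, hQ] with α h1 h2
      exact hΓ.anti (by omega) (hΓ.comm_mem h1 h2)
  | succ n ih =>
    have top1 : ∀ g : G, g ∈ Γ 1 := fun g => by rw [hΓ.one]; trivial
    refine ⟨?_, ?_, ?_, ?_⟩
    · intro k P Q hP hQ
      refine ⟨by filter_upwards [hP.1, hQ.1] with α h1 h2 using mul_mem h1 h2, ?_⟩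
      filter_upwards [hP.2, hQ.2] with β h1 h2
      rw [discDeriv_mul_eq]
      exact ih.mul (ih.mul (ih.conj hΓ h1 hQ.of_succ) (ih.comm_cst hQ.of_succ (top1 _)))
        (ih.conj_cst hΓ h2 _)
    · intro k P hP
      refine ⟨by filter_upwards [hP.1] with α h1 using inv_mem h1, ?_⟩
      filter_upwards [hP.2] with β h1
      rw [discDeriv_inv_eq]
      exact ih.mul (ih.comm_cst (ih.inv hP.of_succ) (top1 _))
        (ih.conj_cst hΓ (ih.conj hΓ (ih.inv h1) (ih.inv hP.of_succ)) _)
    · intro i j Q c hQ hc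
      refine ⟨?_, ?_⟩
      · filter_upwards [hQ.1] with α h1
        exact hΓ.anti (by omega) (hΓ.comm_mem h1 hc)
      filter_upwards [hQ.2] with β h1
      rw [discDeriv_comm_cst_eq]
      refine ih.mul (ih.mul ?_ ?_) ?_
      · exact (ih.comm (ih.comm_cst hQ.of_succ hc) h1).anti hΓ (by omega)
      · exact (ih.comm_cst h1 hc).anti hΓ (by omega)
      · exact ih.comm_cst (ih.comm_cst (ih.mul hQ.of_succ (h1.anti hΓ (by omega))) hc) (top1 _)
    · intro i j P Q hP hQ
      refine ⟨?_, ?_⟩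
      · filter_upwards [hP.1, hQ.1] with α h1 h2
        exact hΓ.anti (by omega) (hΓ.comm_mem h1 h2)
      filter_upwards [hP.2, hQ.2, hP.1, hQ.1] with β dP dQ hp hq
      have hC := ih.comm hP.of_succ hQ.of_succ
      have hP' := ih.mul hP.of_succ (dP.anti hΓ (Nat.le_succ i))
      have hQ' := ih.mul hQ.of_succ (dQ.anti hΓ (Nat.le_succ j))
      rw [discDeriv_comm_eq]
      refine ih.mul (ih.mul (ih.mul (ih.mul (ih.mul ?_ ?_) ?_) ?_) ?_) ?_
      · exact ih.conj hΓ (ih.conj_cst hΓ (ih.comm_cst hP' hq) _) hC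
      · exact ih.conj hΓ (ih.conj hΓ ((ih.comm hP.of_succ dQ).anti hΓ (by omega)) dP) hC
      · exact ih.comm hC (ih.mul (dQ.anti hΓ (by omega)) (dP.anti hΓ (by omega)))
      · exact (ih.comm dP hQ').anti hΓ (by omega)
      · exact ih.comm_cst (ih.comm hP' hQ') (top1 _)
      · exact ih.conj_cst hΓ (ih.conj_cst hΓ ((ih.cst_comm hQ' hp).anti hΓ (by omega)) _) _

theorem IsLevel.one (n k : ℕ) : IsLevel Γ n k (1 : FinSets → G) := by
  induction n generalizing k with
  | zero => exact Eventually.of_forall fun α => one_mem _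
  | succ n ih =>
    refine ⟨Eventually.of_forall fun α => one_mem _, Eventually.of_forall fun β => ?_⟩
    have : discDeriv β (1 : FinSets → G) = 1 := by funext α; simp [discDeriv]
    rw [this]
    exact ih _

theorem IsLevel.eventuallyEq_one {N : ℕ} (hN : Γ (N + 1) = ⊥) {n : ℕ} {Q : FinSets → G}
    (h : IsLevel Γ n N Q) : Q =ᶠ[EE] 1 := by
  filter_upwards [h.mem] with α hα
  simpa [hN] using hα

/-- After enough derivatives the level reaches `N`, where maps are almost everywhere `1` and further
tests are vacuous. -/
theorem IsLevel.succ (hΓ : IsFiltration Γ) {N : ℕ} (hN : Γ (N + 1) = ⊥) {n k : ℕ}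
    (hk : N ≤ k + n) {Q : FinSets → G}
    (h : IsLevel Γ n k Q) : IsLevel Γ (n + 1) k Q := by
  induction n generalizing k Q with
  | zero =>
    have hQ : Q =ᶠ[EE] 1 := (h.anti hΓ (by omega)).eventuallyEq_one hN
    exact (IsLevel.one 1 k).congr hQ.symm
  | succ n ih =>
    refine ⟨h.1, ?_⟩
    filter_upwards [h.2] with β hβ using ih (by omega) hβ

theorem IsIPMap.conj {x : FinSets → G} (hx : IsIPMap x) (c : G) : IsIPMap (conjMap x c) := by
  intro α β h
  simp only [conjMap, hx α β h]
  group

/-- The derivative of `[x, b]` is again a commutator of an IP mapping with a constant, `[x^b, [x(β),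
b]⁻¹]`, whose constant lies one step deeper in the lower central series. -/
theorem IsLevel.ip_comm {x : FinSets → G} (hx : IsIPMap x) {n k j : ℕ} {b : G}
    (hb : b ∈ Subgroup.lowerCentralSeries (⊤ : Subgroup G) j)
    (hΓ : ∀ i, Subgroup.lowerCentralSeries (⊤ : Subgroup G) (j + 1 + i) ≤ Γ (k + 1 + i)) :
    IsLevel Γ n k (comm' x (cst b)) := by
  have hmem : ∀ g : G, comm' g b ∈ Subgroup.lowerCentralSeries (⊤ : Subgroup G) (j + 1) := by
    intro g
    rw [Subgroup.lowerCentralSeries_succ]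
    have := inv_mem (Subgroup.commutator_mem_commutator (inv_mem hb)
      (Subgroup.mem_top g⁻¹))
    simpa [commutatorElement_def, comm', mul_assoc] using this
  induction n generalizing k j b x with
  | zero => exact Eventually.of_forall fun α => hΓ 0 (hmem _)
  | succ n ih =>
    refine ⟨Eventually.of_forall fun α => hΓ 0 (hmem _), Eventually.of_forall fun β => ?_⟩
    have key : comm' (conjMap x b) (cst (comm' (x β) b)⁻¹) =ᶠ[EE]
        discDeriv β (comm' x (cst b)) := by
      filter_upwards [eventually_EE_before β] with α hα
      have hu : FinSets.union α β = FinSets.union β α := Subtype.ext (Finset.union_comm _ _)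
      simp only [discDeriv, comm', conjMap, Pi.mul_apply, Pi.inv_apply, hu, hx β α hα]
      group
    refine IsLevel.congr key ?_
    refine ih (hx.conj b) (inv_mem (hmem (x β))) (fun i => ?_) (fun g => ?_)
    · have := hΓ (1 + i)
      convert this using 2 <;> ring
    · rw [Subgroup.lowerCentralSeries_succ]
      have := inv_mem (Subgroup.commutator_mem_commutator (hmem (x β))
        (Subgroup.mem_top g⁻¹))
      simpa [commutatorElement_def, comm', mul_assoc] using this

/-- The first `d - 1` derivatives cost nothing because `Γ` is still the whole group. They lead to an
IP mapping `x`, whose derivative is almost everywhere `[x, x(β)⁻¹]`. -/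
theorem IsPolyOfDegree.isLevel {d k n : ℕ} {P : FinSets → G} (h : IsPolyOfDegree d P)
    (hΓ : ∀ i, i < d → Γ (k + 1 + i) = ⊤)
    (hΓ' : ∀ i, Subgroup.lowerCentralSeries (⊤ : Subgroup G) i ≤ Γ (k + d + i)) :
    IsLevel Γ n k P := by
  induction d generalizing k n P with
  | zero => exact h.elim
  | succ d ih =>
    have hk : ∀ α, P α ∈ Γ (k + 1) := fun α => by rw [hΓ 0 (by omega)]; trivial
    cases n with
    | zero => exact Eventually.of_forall hk
    | succ n =>
    cases d with
    | zero =>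
      obtain ⟨x, hx, hPx⟩ := h
      refine IsLevel.congr hPx.symm
        ⟨Eventually.of_forall fun α => by rw [hΓ 0 (by omega)]; trivial,
          Eventually.of_forall fun β => ?_⟩
      have key : comm' x (cst (x β)⁻¹) =ᶠ[EE] discDeriv β x := by
        filter_upwards [eventually_EE_before β] with α hα
        have hu : FinSets.union α β = FinSets.union β α := Subtype.ext (Finset.union_comm _ _)
        simp only [discDeriv, comm', Pi.mul_apply, Pi.inv_apply, hu, hx β α hα]
        group
      refine IsLevel.congr key (IsLevel.ip_comm hx (j := 0) (by trivial) fun i => ?_)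
      have := hΓ' (1 + i)
      convert this using 2
      ring
    | succ d =>
      refine ⟨Eventually.of_forall hk, ?_⟩
      filter_upwards [h] with β hβ
      refine ih hβ (fun i hi => ?_) (fun i => ?_)
      · have := hΓ (i + 1) (by omega)
        rw [← this]
        congr 1
        ring
      · have := hΓ' i
        convert this using 2
        ring

/-- An increasing chain of groups of maps, starting with the almost everywhere trivial ones, in
which conjugation and discrete derivatives act trivially up to the preceding term. -/
structure IsPETChain (H : ℕ → Subgroup (FinSets → G)) : Prop where
  mono : Monotone H
  conj : ∀ {i j P Q}, P ∈ H i → Q ∈ H j → P⁻¹ * Q * P ∈ H j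
  comm_cst : ∀ {n Q}, Q ∈ H (n + 1) → ∀ c : G, comm' Q (cst c) ∈ H n
  deriv : ∀ {n Q}, Q ∈ H (n + 1) → ∀ᶠ β in EE, discDeriv β Q ∈ H n
  zero : ∀ {Q}, Q ∈ H 0 ↔ Q =ᶠ[EE] 1

/-- The level filtration is read backwards: `H n` consists of the maps of level `N - n`, and `N`
tests suffice by `IsLevel.succ`. -/
theorem IsFiltration.exists_chain (hΓ : IsFiltration Γ) {N : ℕ} (hN : Γ (N + 1) = ⊥) :
    ∃ H : ℕ → Subgroup (FinSets → G), IsPETChain H ∧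
      ∀ Q, (∀ n, IsLevel Γ n 0 Q) → Q ∈ H N := by
  have L := levelGroups hΓ N
  let H : ℕ → Subgroup (FinSets → G) := fun n =>
    { carrier := {Q | IsLevel Γ N (N - n) Q}
      mul_mem' := fun h1 h2 => L.mul h1 h2
      one_mem' := IsLevel.one _ _
      inv_mem' := fun h => L.inv h }
  have mem : ∀ n Q, Q ∈ H n ↔ IsLevel Γ N (N - n) Q := fun n Q => Iff.rfl
  refine ⟨H, ⟨?_, ?_, ?_, ?_, ?_⟩, ?_⟩
  · exact fun a b hab Q hQ => IsLevel.anti hΓ (by omega) hQ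
  · exact fun hP hQ => L.conj hΓ hQ hP
  · intro n Q hQ c
    exact (L.comm_cst (j := 1) hQ (by rw [hΓ.one]; trivial)).anti hΓ (by omega)
  · intro n Q hQ
    filter_upwards [(IsLevel.succ hΓ hN (by omega) hQ).2] with β hβ
    exact IsLevel.anti hΓ (by omega) hβ
  · intro Q
    exact ⟨fun h => IsLevel.eventuallyEq_one hN h, fun h => (IsLevel.one _ _).congr h.symm⟩
  · intro Q hQ
    rw [mem, Nat.sub_self]
    exact hQ N

theorem exists_petChain [Group.IsNilpotent G] {s : Set (FinSets → G)} (hs : s.Finite)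
    (hpoly : ∀ P ∈ s, IsPolyMap P) :
    ∃ H : ℕ → Subgroup (FinSets → G), IsPETChain H ∧ ∃ N, s ⊆ H N := by
  choose! d hd1 hd using hpoly
  obtain ⟨D, hD⟩ := (hs.image d).bddAbove
  have hD : ∀ P ∈ s, d P ≤ D := fun P hP => hD (Set.mem_image_of_mem d hP)
  obtain ⟨c, hc⟩ := Subgroup.nilpotent_iff_lowerCentralSeries.1 (inferInstance : Group.IsNilpotent G)
  -- Each term of the lower central series is repeated `M` times, so that `Γ` remains the whole
  -- group for as long as degree at most `D` requires.
  set M := D + 1 with hM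
  have hMpos : 0 < M := by omega
  let Γ : ℕ → Subgroup G := fun k => Subgroup.lowerCentralSeries ⊤ ((k - 1) / M)
  have hΓ : IsFiltration Γ := by
    refine ⟨by simp [Γ], by simp [Γ], ?_, ?_⟩
    · intro a b hab
      exact Subgroup.lowerCentralSeries_antitone _ (Nat.div_le_div_right (by omega))
    · have hzero : ∀ j, ⁅Γ 0, Γ j⁆ ≤ Γ j := fun j => by
        have : (Γ j).Normal := by dsimp only [Γ]; infer_instance
        exact Subgroup.commutator_le_right _ _
      intro i j
      rcases Nat.eq_zero_or_pos i with rfl | hi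
      · rw [zero_add]; exact hzero j
      rcases Nat.eq_zero_or_pos j with rfl | hj
      · rw [add_zero, Subgroup.commutator_comm]; exact hzero i
      refine (lowerCentralSeries_commutator_le _ _).trans
        (Subgroup.lowerCentralSeries_antitone _ ?_)
      rw [← Nat.lt_succ_iff, Nat.div_lt_iff_lt_mul hMpos]
      have h1 := Nat.div_add_mod (i - 1) M
      have h2 := Nat.div_add_mod (j - 1) M
      have h3 := Nat.mod_lt (i - 1) hMpos
      have h4 := Nat.mod_lt (j - 1) hMpos
      have h5 : ((i - 1) / M + (j - 1) / M + 1).succ * M =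
        M * ((i - 1) / M) + M * ((j - 1) / M) + M + M := by simp only [Nat.succ_eq_add_one]; ring
      omega
  have hbot : Γ (M * c + 1) = ⊥ := by
    simp only [Γ, Nat.add_sub_cancel, Nat.mul_div_cancel_left c hMpos, hc]
  obtain ⟨H, hH, hN⟩ := hΓ.exists_chain hbot
  refine ⟨H, hH, _, fun P hP => hN P fun n => ?_⟩
  have hdP := hD P hP
  refine (hd P hP).isLevel (fun i hi => ?_) (fun i => ?_)
  · have : (0 + 1 + i - 1) / M = 0 := Nat.div_eq_of_lt (by omega)
    simp only [Γ, this, Subgroup.lowerCentralSeries_zero]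
  · refine Subgroup.lowerCentralSeries_antitone _ ?_
    have := hd1 P hP
    rw [← Nat.lt_succ_iff, Nat.div_lt_iff_lt_mul hMpos]
    have h5 : i.succ * M = i * D + i + D + 1 := by rw [hM, Nat.succ_eq_add_one]; ring
    rw [h5]
    have : 0 ≤ i * D := Nat.zero_le _
    omega

end Filtered

/-! ### Minimal left ideals and idempotents in the closure of `F`. -/

section Ultra

variable {G : Type*}

theorem isClosed_filterClosure (F : Filter G) : IsClosed (filterClosure F) := by
  have : filterClosure F = ⋂ A ∈ F, {p : Ultrafilter G | A ∈ p} := by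
    ext p; simp [filterClosure]
  rw [this]
  exact isClosed_biInter fun A _ => ultrafilter_isClosed_basic A

theorem filterClosure_nonempty (F : Filter G) [F.NeBot] : (filterClosure F).Nonempty :=
  ⟨Ultrafilter.of F, fun _ hA => Ultrafilter.of_le F hA⟩

variable [Group G]

attribute [local instance] Ultrafilter.semigroup

theorem mem_mul {p q : Ultrafilter G} {A : Set G} :
    A ∈ p * q ↔ {x : G | {y : G | x * y ∈ A} ∈ q} ∈ p := mem_ultraMul

theorem mul_mem_filterClosure {F : Filter G} (hF : IsIdempotentFilter F) {p q : Ultrafilter G}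
    (hp : p ∈ filterClosure F) (hq : q ∈ filterClosure F) : p * q ∈ filterClosure F := by
  intro A hA
  refine mem_mul.2 (mem_of_superset (hp _ (isIdempotentFilter_iff.1 hF A hA)) ?_)
  exact fun x hx => hq _ hx

/-- Nonempty closed left ideals of `T`. -/
structure IsClosedLeftIdeal (T L : Set (Ultrafilter G)) : Prop where
  closed : IsClosed L
  nonempty : L.Nonempty
  subset : L ⊆ T
  mul_mem : ∀ t ∈ T, ∀ p ∈ L, t * p ∈ L

theorem exists_minimal_leftIdeal {T : Set (Ultrafilter G)} (hT : IsClosedLeftIdeal T T) :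
    ∃ L, Minimal (IsClosedLeftIdeal T) L := by
  refine zorn_superset {L | IsClosedLeftIdeal T L} fun c hcs hc => ?_
  rcases c.eq_empty_or_nonempty with rfl | hne
  · exact ⟨T, hT, by simp⟩
  refine ⟨⋂₀ c, ⟨isClosed_sInter fun t ht => (hcs ht).closed, ?_, ?_, ?_⟩,
    fun s hs => Set.sInter_subset_of_mem hs⟩
  · have := hne.coe_sort
    rw [Set.sInter_eq_iInter]
    refine IsCompact.nonempty_iInter_of_directed_nonempty_isCompact_isClosed
      ((↑) : c → Set (Ultrafilter G)) (DirectedOn.directed_val (IsChain.directedOn hc.symm))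
      (fun i => (hcs i.2).nonempty) (fun i => (hcs i.2).closed.isCompact)
      (fun i => (hcs i.2).closed)
  · obtain ⟨L, hL⟩ := hne
    exact (Set.sInter_subset_of_mem hL).trans (hcs hL).subset
  · intro t ht p hp L hL
    exact (hcs hL).mul_mem t ht p (hp L hL)

theorem IsClosedLeftIdeal.image_mul {T L : Set (Ultrafilter G)}
    (hT : ∀ p ∈ T, ∀ q ∈ T, p * q ∈ T) (hL : IsClosedLeftIdeal T L) {t : Ultrafilter G}
    (ht : t ∈ T) : IsClosedLeftIdeal T ((· * t) '' L) := by
  refine ⟨?_, hL.nonempty.image _, ?_, ?_⟩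
  · exact (hL.closed.isCompact.image (Ultrafilter.continuous_mul_left t)).isClosed
  · rintro _ ⟨p, hp, rfl⟩
    exact hT _ (hL.subset hp) _ ht
  · rintro s hs _ ⟨p, hp, rfl⟩
    exact ⟨s * p, hL.mul_mem s hs p hp, mul_assoc _ _ _⟩

theorem minimal_image_mul {T L : Set (Ultrafilter G)}
    (hT : ∀ p ∈ T, ∀ q ∈ T, p * q ∈ T) (hL : Minimal (IsClosedLeftIdeal T) L)
    {t : Ultrafilter G} (ht : t ∈ T) : Minimal (IsClosedLeftIdeal T) ((· * t) '' L) := by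
  refine ⟨hL.prop.image_mul hT ht, fun M hM hML => ?_⟩
  have hN : IsClosedLeftIdeal T (L ∩ (· * t) ⁻¹' M) := by
    refine ⟨hL.prop.closed.inter (hM.closed.preimage (Ultrafilter.continuous_mul_left t)), ?_,
      Set.inter_subset_left.trans hL.prop.subset, ?_⟩
    · obtain ⟨m, hm⟩ := hM.nonempty
      obtain ⟨p, hp, rfl⟩ := hML hm
      exact ⟨p, hp, hm⟩
    · rintro s hs p ⟨hp, hpM⟩
      refine ⟨hL.prop.mul_mem s hs p hp, ?_⟩
      have := hM.mul_mem s hs _ hpM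
      rwa [← mul_assoc] at this
  rintro _ ⟨p, hp, rfl⟩
  exact (hL.le_of_le hN Set.inter_subset_left hp).2

/-- An idempotent in a minimal left ideal of the closure of `F`. -/
structure IsMinimalIdempotent (F : Filter G) (e : Ultrafilter G) : Prop where
  mem : e ∈ filterClosure F
  idem : e * e = e
  returns : ∀ t ∈ filterClosure F, ∃ s ∈ filterClosure F, s * (t * e) = e

/-- The union of the minimal closed left ideals is a two-sided ideal, so `p` lies in one of them,
`L`. An idempotent `e ∈ L` generates `L`, hence is a right identity on it. -/
theorem exists_minimalIdempotent {F : Filter G} [F.NeBot] (hF : IsIdempotentFilter F)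
    {p : Ultrafilter G} (hp : p ∈ smallestIdeal (filterClosure F)) :
    p ∈ filterClosure F ∧ ∃ e, IsMinimalIdempotent F e ∧ p * e = p := by
  set T := filterClosure F with hTdef
  have hT : ∀ p ∈ T, ∀ q ∈ T, p * q ∈ T := fun p hp q hq => mul_mem_filterClosure hF hp hq
  have hTL : IsClosedLeftIdeal T T :=
    ⟨isClosed_filterClosure F, filterClosure_nonempty F, le_rfl, hT⟩
  obtain ⟨L₀, hL₀⟩ := exists_minimal_leftIdeal hTL
  have hI : IsTwoSidedIdeal T {q | ∃ L, Minimal (IsClosedLeftIdeal T) L ∧ q ∈ L} := by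
    refine ⟨?_, ?_, ?_, ?_⟩
    · obtain ⟨q, hq⟩ := hL₀.prop.nonempty
      exact ⟨q, L₀, hL₀, hq⟩
    · rintro q ⟨L, hL, hq⟩
      exact hL.prop.subset hq
    · rintro t ht q ⟨L, hL, hq⟩
      exact ⟨L, hL, hL.prop.mul_mem t ht q hq⟩
    · rintro t ht q ⟨L, hL, hq⟩
      exact ⟨_, minimal_image_mul hT hL ht, q, hq, rfl⟩
  obtain ⟨L, hL, hpL⟩ := hp _ hI
  have hgen : ∀ q ∈ L, ∀ r ∈ L, ∃ s ∈ T, s * q = r := by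
    intro q hq r hr
    have h1 := hTL.image_mul hT (hL.prop.subset hq)
    have h2 : (· * q) '' T ⊆ L := by
      rintro _ ⟨s, hs, rfl⟩
      exact hL.prop.mul_mem s hs q hq
    obtain ⟨s, hs, h⟩ := hL.le_of_le h1 h2 hr
    exact ⟨s, hs, h⟩
  obtain ⟨e, heL, hee⟩ := exists_idempotent_in_compact_subsemigroup
    Ultrafilter.continuous_mul_left L hL.prop.nonempty hL.prop.closed.isCompact
    (fun x hx y hy => hL.prop.mul_mem x (hL.prop.subset hx) y hy)
  refine ⟨hL.prop.subset hpL, e, ⟨hL.prop.subset heL, hee, fun t ht => ?_⟩, ?_⟩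
  · exact hgen _ (hL.prop.mul_mem t ht e heL) e heL
  · obtain ⟨s, -, rfl⟩ := hgen e heL p hpL
    rw [mul_assoc, hee]

/-- The points `x` with `x⁻¹ A ∈ e`. -/
def returnSet (e : Filter G) (A : Set G) : Set G := {x | {y | x * y ∈ A} ∈ e}

theorem IsMinimalIdempotent.returnSet_mem {F : Filter G} {e : Ultrafilter G}
    (he : IsMinimalIdempotent F e) {A : Set G} (hA : A ∈ e) : returnSet e A ∈ e := by
  rw [← he.idem] at hA
  exact mem_mul.1 hA

theorem IsMinimalIdempotent.translate_returnSet {F : Filter G} {e : Ultrafilter G}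
    (he : IsMinimalIdempotent F e) {A : Set G} {x : G} (hx : x ∈ returnSet e A) :
    {y | x * y ∈ returnSet e A} ∈ e := by
  have := he.returnSet_mem (A := {y | x * y ∈ A}) hx
  refine mem_of_superset this fun y hy => ?_
  simpa only [returnSet, Set.mem_ofPred_eq, mul_assoc] using hy

/-- For `t` extending `F`, `s * (t * e) = e` yields `x ∈ C` with `x⁻¹ (returnSet e A) ∈ t`.
Compactness of the closure leaves finitely many `x`. -/
theorem IsMinimalIdempotent.exists_cover {F : Filter G} {e : Ultrafilter G}
    (he : IsMinimalIdempotent F e) {A : Set G} (hA : A ∈ e) {C : Set G} (hC : C ∈ F) :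
    ∃ X : Finset G, (∀ x ∈ X, x ∈ C) ∧ {u | ∃ x ∈ X, x * u ∈ returnSet e A} ∈ F := by
  have hcov : filterClosure F ⊆ ⋃ x : C, {t : Ultrafilter G | {u | x.1 * u ∈ returnSet e A} ∈ t} := by
    intro t ht
    obtain ⟨s, hs, hst⟩ := he.returns t ht
    rw [← hst] at hA
    have h1 := mem_mul.1 hA
    obtain ⟨x, hx1, hxC⟩ := s.nonempty_of_mem (inter_mem h1 (hs _ hC))
    refine Set.mem_iUnion.2 ⟨⟨x, hxC⟩, ?_⟩
    have := mem_mul.1 hx1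
    refine mem_of_superset this fun z hz => ?_
    simp only [returnSet, Set.mem_ofPred_eq, mul_assoc] at hz ⊢
    exact hz
  obtain ⟨X, hX⟩ := (isClosed_filterClosure F).isCompact.elim_finite_subcover _
    (fun x => ultrafilter_isOpen_basic _) hcov
  classical
  refine ⟨X.image Subtype.val, fun x hx => ?_, ?_⟩
  · obtain ⟨y, -, rfl⟩ := Finset.mem_image.1 hx
    exact y.2
  · rw [mem_iff_ultrafilter]
    intro t ht
    obtain ⟨x, hx, hxt⟩ := Set.mem_iUnion₂.1 (hX (fun B hB => ht hB : t ∈ filterClosure F))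
    exact mem_of_superset hxt fun u hu => ⟨x.1, Finset.mem_image_of_mem _ hx, hu⟩

/-- The core of `V`: the `x ∈ V` with `x⁻¹ V ∈ F`. -/
theorem IsIdempotentFilter.exists_core {F : Filter G} (hF : IsIdempotentFilter F) {V : Set G}
    (hV : V ∈ F) : ∃ W ∈ F, W ⊆ V ∧ ∀ x ∈ W, {y | x * y ∈ W} ∈ F := by
  have key := isIdempotentFilter_iff.1 hF
  refine ⟨V ∩ returnSet F V, inter_mem hV (key V hV), Set.inter_subset_left, ?_⟩
  rintro x ⟨-, hx⟩
  filter_upwards [hx, key _ hx] with y h1 h2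
  refine ⟨h1, ?_⟩
  simpa only [returnSet, Set.mem_ofPred_eq, mul_assoc] using h2

end Ultra

/-! ### Colour focusing. -/

section Focusing

variable {G : Type*} [Group G]

/-- The value of a map at a finite set, with the value `1` at the empty set. -/
noncomputable def valueAt (P : FinSets → G) (s : Finset ℕ) : G :=
  if h : s.Nonempty then P ⟨s, h⟩ else 1

/-- `α ∪ s` for a possibly empty `s`. -/
def adjoin (α : FinSets) (s : Finset ℕ) : FinSets :=
  ⟨α.1 ∪ s, α.2.mono Finset.subset_union_left⟩

@[simp] theorem valueAt_empty (P : FinSets → G) : valueAt P ∅ = 1 := by simp [valueAt]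

@[simp] theorem valueAt_coe (P : FinSets → G) (α : FinSets) : valueAt P α.1 = P α := by
  simp [valueAt, α.2]

@[simp] theorem valueAt_union (P : FinSets → G) (α : FinSets) (s : Finset ℕ) :
    valueAt P (α.1 ∪ s) = P (adjoin α s) := valueAt_coe P (adjoin α s)

@[simp] theorem adjoin_empty (α : FinSets) : adjoin α ∅ = α := Subtype.ext (Finset.union_empty _)

theorem adjoin_coe (α β : FinSets) : adjoin α β.1 = FinSets.union α β := rfl

theorem adjoin_union (α β : FinSets) (s : Finset ℕ) :
    adjoin α (β.1 ∪ s) = adjoin (FinSets.union α β) s :=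
  Subtype.ext (Finset.union_assoc _ _ _).symm

/-- The change of `z S w` relative to the current position `(γ, ω)`. -/
noncomputable def relMap (z S : FinSets → G) (γ ω : Finset ℕ) (w : G) : FinSets → G := fun α =>
  (valueAt z γ * (valueAt S ω * w))⁻¹ * (z (adjoin α γ) * (S (adjoin α ω) * w))

/-- The right-hand side has the form `(R D_α P)^c` of axiom (IV), so moving a thread keeps its
relative map in `PP`. -/
theorem relMap_union (z S : FinSets → G) (γ ω : Finset ℕ) (w t : G) (α : FinSets) :
    relMap z S (α.1 ∪ γ) (α.1 ∪ ω) (w * t) =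
      conjMap (relMap z S γ ω w * discDeriv α (relMap z S γ ω w)) (relMap z S γ ω w α * t) := by
  funext α'
  simp only [relMap, conjMap, discDeriv, Pi.mul_apply, valueAt_union, adjoin_union]
  group

theorem relMap_empty_empty (z S : FinSets → G) (w : G) :
    relMap z S ∅ ∅ w = conjMap (z * S) w := by
  funext α
  simp only [relMap, conjMap, Pi.mul_apply, valueAt_empty, adjoin_empty]
  group

theorem relMap_empty_coe (z S : FinSets → G) (ω : FinSets) (w : G) :
    relMap z S ∅ ω.1 w = conjMap (z * S * discDeriv ω S) (S ω * w) := by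
  funext α
  simp only [relMap, conjMap, discDeriv, Pi.mul_apply, valueAt_empty, valueAt_coe, adjoin_empty,
    adjoin_coe]
  group

theorem value_relMap (z S : FinSets → G) (γ ω : Finset ℕ) (w t : G) (α : FinSets) :
    valueAt z (α.1 ∪ γ) * (valueAt S (α.1 ∪ ω) * (w * t)) =
      valueAt z γ * (valueAt S ω * w) * (relMap z S γ ω w α * t) := by
  simp only [relMap, valueAt_union]
  group

/-- `Q'` differs from `Q` by terms of lower level. -/
def IsPerturbation (H : ℕ → Subgroup (FinSets → G)) (Q Q' : FinSets → G) : Prop :=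
  ∀ n, Q ∈ H (n + 1) → Q' * Q⁻¹ ∈ H n

variable {H : ℕ → Subgroup (FinSets → G)}

theorem IsPETChain.conjMap_mul (hH : IsPETChain H) {Q D : FinSets → G}
    (hD : ∀ n, Q ∈ H (n + 1) → D ∈ H n) (c : G) : IsPerturbation H Q (conjMap (Q * D) c) := by
  intro n hQ
  have h1 : Q * D ∈ H (n + 1) := mul_mem hQ (hH.mono (Nat.le_succ n) (hD n hQ))
  have h2 := hH.conj (inv_mem hQ) (mul_mem (hD n hQ) (hH.comm_cst h1 c))
  convert h2 using 1
  funext α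
  simp only [conjMap, comm', Pi.mul_apply, Pi.inv_apply]
  group

theorem IsPETChain.perturbation_conj (hH : IsPETChain H) (Q : FinSets → G) (c : G) :
    IsPerturbation H Q (conjMap Q c) := by
  simpa using hH.conjMap_mul (Q := Q) (D := 1) (fun n _ => one_mem _) c

theorem IsPETChain.eventually_perturbation (hH : IsPETChain H) {Q : FinSets → G} {N : ℕ}
    (hQ : Q ∈ H N) :
    ∀ᶠ γ in EE, ∀ c, IsPerturbation H Q (conjMap (Q * discDeriv γ Q) c) := by
  classical
  -- Derivatives are controlled at the least such `n`; monotonicity then covers all larger ones with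
  -- the same set of `γ`.
  have hex : ∃ n, Q ∈ H (n + 1) := ⟨N, hH.mono (Nat.le_succ N) hQ⟩
  filter_upwards [hH.deriv (Nat.find_spec hex)] with γ hγ c
  exact hH.conjMap_mul (fun n hn => hH.mono (Nat.find_min' hex hn) hγ) c

/-- Recurrence for the maps in `M`, with all maps in a finite subset of `PP` under control. -/
def Recurs (F : Filter G) (e : Ultrafilter G) (PP M : Set (FinSets → G)) : Prop :=
  ∀ R : Set (FinSets → G), R.Finite → R ⊆ PP → ∀ β : FinSets, ∀ V ∈ F, ∀ A ∈ e,
    ∃ α : FinSets, β.Before α ∧ ∃ w : G, (∀ P ∈ R, P α * w ∈ V) ∧ ∀ P ∈ M, P α * w ∈ A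

variable {F : Filter G} {e : Ultrafilter G} {PP : Set (FinSets → G)}

theorem Recurs.mono {M N : Set (FinSets → G)} (h : Recurs F e PP N) (hMN : M ⊆ N) :
    Recurs F e PP M := by
  intro R hR hRP β V hV A hA
  obtain ⟨α, hα, w, h1, h2⟩ := h R hR hRP β V hV A hA
  exact ⟨α, hα, w, h1, fun P hP => h2 P (hMN hP)⟩

theorem exists_before_both (β : FinSets) {s : Set FinSets} (hs : s ∈ EE) :
    ∃ γ : FinSets, ∀ α, γ.Before α → β.Before α ∧ α ∈ s := by
  obtain ⟨δ, hδ⟩ := mem_EE.1 hs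
  exact ⟨FinSets.union β δ, fun α hα =>
    ⟨FinSets.Before.of_union_left hα, hδ α (FinSets.Before.of_union_right hα)⟩⟩

theorem Recurs.of_eventuallyEq {M N : Set (FinSets → G)} (hM : M.Finite)
    (hMN : ∀ P ∈ M, ∃ Q ∈ N, P =ᶠ[EE] Q) (h : Recurs F e PP N) : Recurs F e PP M := by
  intro R hR hRP β V hV A hA
  choose! f hf1 hf2 using hMN
  obtain ⟨γ, hγ⟩ := exists_before_both β ((eventually_all_finite hM).2 hf2)
  obtain ⟨α, hα, w, h1, h2⟩ := h R hR hRP γ V hV A hA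
  refine ⟨α, (hγ α hα).1, w, h1, fun P hP => ?_⟩
  rw [show P α = f P α from (hγ α hα).2 P hP]
  exact h2 _ (hf1 P hP)

/-- Measurability puts `P α` in a core of `V` or makes it `1`; in both cases `F`-almost every `w`
works. -/
theorem recurs_empty [F.NeBot] (hF : IsIdempotentFilter F) (hPP : IsGoodCollection F PP) :
    Recurs F e PP ∅ := by
  intro R hR hRP β V hV A hA
  obtain ⟨W, hW, hWV, hcore⟩ := hF.exists_core hV
  have h1 : ∀ᶠ α in EE, ∀ P ∈ R, P α ∈ W ∪ {1} :=
    (eventually_all_finite hR).2 fun P hP => hPP.measurable P (hRP hP) W hW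
  obtain ⟨γ, hγ⟩ := exists_before_both β h1
  obtain ⟨α, hα⟩ := (eventually_EE_before γ).exists
  have h2 : ∀ᶠ w in F, ∀ P ∈ R, P α * w ∈ W := by
    refine (eventually_all_finite hR).2 fun P hP => ?_
    rcases (hγ α hα).2 P hP with h | h
    · exact hcore _ h
    · rw [Set.mem_singleton_iff.1 h]
      simpa using hW
  obtain ⟨w, hw⟩ := h2.exists
  exact ⟨α, (hγ α hα).1, w, fun P hP => hWV (hw P hP), fun P hP => hP.elim⟩

theorem IsGoodCollection.eventually_conjMap (hPP : IsGoodCollection F PP) {R : FinSets → G}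
    (hR : R ∈ PP) : ∀ᶠ c in F, conjMap R c ∈ PP := by
  filter_upwards [hPP.conj_mem R hR 1 hPP.one_mem] with c hc
  convert hc using 1
  funext α
  simp [conjMap, commMap]

/-- Axiom (III) applies because `Q^c S = (QS)^c [c, S]`. -/
theorem IsGoodCollection.eventually_conjMap_mul (hPP : IsGoodCollection F PP)
    {Q S : FinSets → G} (hS : S ∈ PP) (hQS : Q * S ∈ PP) :
    ∀ᶠ c in F, conjMap Q c * S ∈ PP := by
  filter_upwards [hPP.conj_mem _ hQS S hS] with c hc
  convert hc using 1
  funext α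
  simp only [conjMap, commMap, Pi.mul_apply]
  group

/-- Colour focusing: recurrence of one point in each colour along `α` and all the points that the
maps in `QS` reach from it. The state consists of the set `J` of the colours that occur already,
the positions `γ y` for the colours `y ∈ J`, and the common position `ω`, `w`. -/
theorem exists_focused [DecidableEq G] (hPP : IsGoodCollection F PP)
    (he : IsMinimalIdempotent F e) (hH : IsPETChain H) {S : FinSets → G}
    {QS Z : Set (FinSets → G)} (hQS : QS.Finite) (hZ : Z.Finite) (h1Z : 1 ∈ Z)
    (hstep : ∀ (S' : FinSets → G) (QS' : Set (FinSets → G)), QS'.Finite →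
      (∀ Q' ∈ QS', Q' * S' ∈ PP ∧ ∃ Q ∈ QS, IsPerturbation H Q Q') →
      Recurs F e PP ((· * S') '' QS'))
    {A V : Set G} (hVcore : ∀ x ∈ V, {y | x * y ∈ V} ∈ F) {X : Finset G}
    (hQZ : ∀ Q ∈ QS, ∀ x ∈ X, conjMap Q x ∈ Z)
    (hVX : ∀ u ∈ V, ∃ x ∈ X, x * u ∈ returnSet e A)
    (hVZ : ∀ u ∈ V, ∀ z ∈ Z, conjMap (z * S) u ∈ PP) {b : FinSets}
    (hbZ : ∀ ω : FinSets, b.Before ω → ∀ u ∈ V, ∀ z ∈ Z, conjMap (z * S * discDeriv ω S) u ∈ PP)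
    (hbQ : ∀ γ : FinSets, b.Before γ → ∀ Q ∈ QS, ∀ c,
      IsPerturbation H Q (conjMap (Q * discDeriv γ Q) c))
    (m : ℕ) (J : Finset G) (hm : (X \ J).card ≤ m) (γ : G → Finset ℕ) (ω : Finset ℕ) (w : G)
    (hω : ∀ h : ω.Nonempty, b.Before ⟨ω, h⟩) (hu : valueAt S ω * w ∈ V)
    (hne : ∀ y ∈ J, (γ y).Nonempty) (hγ : ∀ y ∈ J, ∀ h : (γ y).Nonempty, b.Before ⟨γ y, h⟩)
    (hJX : J ⊆ X)
    (hJV : ∀ y ∈ J, ∀ z ∈ Z, valueAt z (γ y) * (valueAt S ω * w) ∈ V)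
    (hJP : ∀ y ∈ J, ∀ z ∈ Z, relMap z S (γ y) ω w ∈ PP)
    (hJA : ∀ y ∈ J, ∀ Q ∈ QS,
      y * (valueAt (conjMap Q y) (γ y) * (valueAt S ω * w)) ∈ returnSet e A) :
    ∃ α : FinSets, b.Before α ∧ ∃ x ∈ X, ∃ u, x * u ∈ returnSet e A ∧
      (∀ Q ∈ QS, x * (conjMap Q x α * u) ∈ returnSet e A) ∧ ∀ z ∈ Z, z α * u ∈ V := by
  classical
  induction m generalizing J γ ω w with
  | zero =>
    -- No colour is left over, so that of the current point has a thread, and its position is the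
    -- required `α`.
    obtain ⟨x, hxX, hx⟩ := hVX _ hu
    have hxJ : x ∈ J := by
      have : X \ J = ∅ := Finset.card_eq_zero.1 (by omega)
      exact (Finset.sdiff_eq_empty_iff_subset.1 this) hxX
    refine ⟨⟨γ x, hne x hxJ⟩, hγ x hxJ _, x, hxX, _, hx, fun Q hQ => ?_, fun z hz => ?_⟩
    · have := hJA x hxJ Q hQ
      rwa [valueAt, dif_pos (hne x hxJ)] at this
    · have := hJV x hxJ z hz
      rwa [valueAt, dif_pos (hne x hxJ)] at this
  | succ m ih =>
    obtain ⟨x, hxX, hx⟩ := hVX _ hu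
    by_cases hxJ : x ∈ J
    · refine ⟨⟨γ x, hne x hxJ⟩, hγ x hxJ _, x, hxX, _, hx, fun Q hQ => ?_, fun z hz => ?_⟩
      · have := hJA x hxJ Q hQ
        rwa [valueAt, dif_pos (hne x hxJ)] at this
      · have := hJV x hxJ z hz
        rwa [valueAt, dif_pos (hne x hxJ)] at this
    set u := valueAt S ω * w with hudef
    -- The new colour opens a thread at the empty position, where it sits at `u` itself.
    let δ : G → Finset ℕ := fun y => if y = x then ∅ else γ y
    have hδx : δ x = ∅ := if_pos rfl
    have hδJ : ∀ y ∈ J, δ y = γ y := fun y hy => if_neg (by rintro rfl; exact hxJ hy)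
    have ext : ∀ {p : G → Finset ℕ → Prop}, p x ∅ → (∀ y ∈ J, p y (γ y)) →
        ∀ y ∈ insert x J, p y (δ y) := by
      intro p h1 h2 y hy
      rcases Finset.mem_insert.1 hy with rfl | hy
      · rwa [hδx]
      · rw [hδJ y hy]; exact h2 y hy
    have dB : ∀ y ∈ insert x J, ∀ h : (δ y).Nonempty, b.Before ⟨δ y, h⟩ :=
      ext (p := fun _ s => ∀ h : s.Nonempty, b.Before ⟨s, h⟩) (fun h => (by simp at h)) hγ
    have dV : ∀ y ∈ insert x J, ∀ z ∈ Z, valueAt z (δ y) * u ∈ V :=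
      ext (p := fun _ s => ∀ z ∈ Z, valueAt z s * u ∈ V) (fun z _ => by simpa using hu) hJV
    have dP : ∀ y ∈ insert x J, ∀ z ∈ Z, relMap z S (δ y) ω w ∈ PP := by
      refine ext (p := fun _ s => ∀ z ∈ Z, relMap z S s ω w ∈ PP) (fun z hz => ?_) hJP
      rcases ω.eq_empty_or_nonempty with rfl | hω'
      · rw [relMap_empty_empty]
        exact hVZ _ (by simpa [hudef] using hu) z hz
      · have h1 := relMap_empty_coe z S ⟨ω, hω'⟩ w
        have h2 : S ⟨ω, hω'⟩ * w ∈ V := by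
          have := valueAt_coe S ⟨ω, hω'⟩
          rw [← this]; exact hu
        rw [h1]
        exact hbZ _ (hω hω') _ h2 z hz
    have dA : ∀ y ∈ insert x J, ∀ Q ∈ QS, y * (valueAt (conjMap Q y) (δ y) * u) ∈ returnSet e A :=
      ext (p := fun y s => ∀ Q ∈ QS, y * (valueAt (conjMap Q y) s * u) ∈ returnSet e A)
        (fun Q _ => by simpa using hx) hJA
    have dX : insert x J ⊆ X := Finset.insert_subset hxX hJX
    -- The relative motion of a thread factors as `q Q y * S'`: the common part `S'` and a
    -- perturbation of `Q`, to which `hstep` applies.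
    let S' : FinSets → G := fun α => u⁻¹ * (S (adjoin α ω) * w)
    let q : (FinSets → G) → G → FinSets → G := fun Q y α =>
      u⁻¹ * ((valueAt (conjMap Q y) (δ y))⁻¹ * conjMap Q y (adjoin α (δ y))) * u
    have hqS : ∀ Q y, q Q y * S' = relMap (conjMap Q y) S (δ y) ω w := by
      intro Q y
      funext α
      simp only [q, S', relMap, Pi.mul_apply, hudef]
      group
    have hqP : ∀ Q ∈ QS, ∀ y ∈ insert x J, IsPerturbation H Q (q Q y) := by
      intro Q hQ y hy
      rcases (δ y).eq_empty_or_nonempty with h0 | h0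
      · have : q Q y = conjMap Q (y * u) := by
          funext α
          simp only [q, h0, valueAt_empty, adjoin_empty, conjMap]
          group
        rw [this]
        exact hH.perturbation_conj Q _
      · have : q Q y = conjMap (Q * discDeriv ⟨δ y, h0⟩ Q) (Q ⟨δ y, h0⟩ * (y * u)) := by
          funext α
          have h1 : adjoin α (δ y) = FinSets.union α ⟨δ y, h0⟩ := rfl
          simp only [q, valueAt, dif_pos h0, h1, conjMap, discDeriv, Pi.mul_apply]
          group
        rw [this]
        exact hbQ _ (dB y hy h0) Q hQ _
    have hrec := hstep S' (Set.image2 q QS ↑(insert x J)) (hQS.image2 q (Finset.finite_toSet _)) (by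
      rintro _ ⟨Q, hQ, y, hy, rfl⟩
      refine ⟨?_, Q, hQ, hqP Q hQ y hy⟩
      rw [hqS]
      exact dP y hy _ (hQZ Q hQ y (dX hy)))
    let R : Set (FinSets → G) := Set.image2 (fun z y => relMap z S (δ y) ω w) Z ↑(insert x J)
    have hR : R.Finite := hZ.image2 _ (Finset.finite_toSet _)
    have hRP : R ⊆ PP := by
      rintro _ ⟨z, hz, y, hy, rfl⟩
      exact dP y hy z hz
    have hD : ∀ Φ ∈ R, ∃ C ∈ F, ∃ T ∈ EE, ∀ c ∈ C, ∀ β ∈ T,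
        conjMap (Φ * discDeriv β Φ) c ∈ PP := fun Φ hΦ =>
      hPP.deriv_mem Φ (hRP hΦ) Φ (hRP hΦ)
    choose! C hC T hT hCT using hD
    obtain ⟨b', hb'⟩ := exists_before_both b ((eventually_all_finite hR).2 hT)
    -- The values of the relative maps must stay in the core and also be admissible conjugators for
    -- (IV).
    have hV' : {v | (∀ Φ ∈ R, v ∈ C Φ) ∧ ∀ y ∈ insert x J, ∀ z ∈ Z,
        valueAt z (δ y) * u * v ∈ V} ∈ F := by
      refine ((eventually_all_finite hR).2 hC).and ?_
      refine (eventually_all_finset _).2 fun y hy => (eventually_all_finite hZ).2 fun z hz => ?_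
      exact hVcore _ (dV y hy z hz)
    have hA' : {v | ∀ y ∈ insert x J, ∀ Q ∈ QS,
        y * (valueAt (conjMap Q y) (δ y) * u) * v ∈ returnSet e A} ∈ (e : Filter G) := by
      refine (eventually_all_finset _).2 fun y hy => (eventually_all_finite hQS).2 fun Q hQ => ?_
      exact he.translate_returnSet (dA y hy Q hQ)
    obtain ⟨α, hα, t, ht1, ht2⟩ := hrec R hR hRP b' _ hV' _ hA'
    have hbα := (hb' α hα).1
    have hval : ∀ z y, valueAt z (α.1 ∪ δ y) * (valueAt S (α.1 ∪ ω) * (w * t)) =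
        valueAt z (δ y) * u * (relMap z S (δ y) ω w α * t) := fun z y =>
      value_relMap z S (δ y) ω w t α
    have hxx := Finset.mem_insert_self x J
    have bnd : ∀ s : Finset ℕ, (∀ h : s.Nonempty, b.Before ⟨s, h⟩) →
        ∀ h : (α.1 ∪ s).Nonempty, b.Before ⟨α.1 ∪ s, h⟩ := by
      intro s hs h a ha c hc
      rcases Finset.mem_union.1 hc with hc | hc
      · exact hbα a ha c hc
      · exact hs ⟨c, hc⟩ a ha c hc
    have newV : ∀ y ∈ insert x J, ∀ z ∈ Z,
        valueAt z (α.1 ∪ δ y) * (valueAt S (α.1 ∪ ω) * (w * t)) ∈ V := by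
      intro y hy z hz
      rw [hval]
      exact (ht1 _ ⟨z, hz, y, hy, rfl⟩).2 y hy z hz
    refine ih (insert x J) ?_ (fun y => α.1 ∪ δ y) (α.1 ∪ ω) (w * t) (bnd ω hω) ?_
      (fun y _ => α.2.mono Finset.subset_union_left) (fun y hy => bnd _ (dB y hy)) dX newV ?_ ?_
    · rw [Finset.sdiff_insert]
      have hmem : x ∈ X \ J := Finset.mem_sdiff.2 ⟨hxX, hxJ⟩
      rw [Finset.card_erase_of_mem hmem]
      omega
    · have h1 := newV x hxx 1 h1Z
      simpa using h1
    · intro y hy z hz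
      have hΦ : relMap z S (δ y) ω w ∈ R := ⟨z, hz, y, hy, rfl⟩
      rw [relMap_union]
      exact hCT _ hΦ _ ((ht1 _ hΦ).1 _ hΦ) α ((hb' α hα).2 _ hΦ)
    · intro y hy Q hQ
      rw [hval, ← hqS, ← mul_assoc]
      exact ht2 _ ⟨_, ⟨Q, hQ, y, hy, rfl⟩, rfl⟩ y hy Q hQ

/-- Sets up the focusing from the empty state and, after a colour repeats, uses `e` to pass from
`returnSet e A` to `A`. -/
theorem recurs_of_perturbations [F.NeBot] (hF : IsIdempotentFilter F)
    (hPP : IsGoodCollection F PP)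
    (he : IsMinimalIdempotent F e) (hH : IsPETChain H) {S : FinSets → G}
    {QS : Set (FinSets → G)} (hQS : QS.Finite) (hS : S ∈ PP) (hQP : ∀ Q ∈ QS, Q * S ∈ PP)
    (hQH : ∀ Q ∈ QS, ∃ N, Q ∈ H N)
    (hstep : ∀ (S' : FinSets → G) (QS' : Set (FinSets → G)), QS'.Finite →
      (∀ Q' ∈ QS', Q' * S' ∈ PP ∧ ∃ Q ∈ QS, IsPerturbation H Q Q') →
      Recurs F e PP ((· * S') '' QS')) :
    Recurs F e PP (insert S ((· * S) '' QS)) := by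
  classical
  intro R hR hRP β V hV A hA
  -- Dividing `R` by `S` writes the maps to be controlled as `y * S`, like the recurrent ones.
  let Y : Set (FinSets → G) := insert 1 ((· * S⁻¹) '' R ∪ QS)
  have hY : Y.Finite := ((hR.image _).union hQS).insert 1
  have hYP : ∀ y ∈ Y, y * S ∈ PP := by
    rintro y (rfl | ⟨P, hP, rfl⟩ | hy)
    · rwa [one_mul]
    · simpa using hRP hP
    · exact hQP y hy
  obtain ⟨W, hW, hWV, hWcore⟩ := hF.exists_core hV
  have hC : ∀ᶠ c in F, ∀ y ∈ Y, conjMap y c * S ∈ PP :=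
    (eventually_all_finite hY).2 fun y hy => hPP.eventually_conjMap_mul hS (hYP y hy)
  obtain ⟨X, hXC, hX⟩ := he.exists_cover hA (inter_mem hC hW)
  let Z : Set (FinSets → G) := insert 1 (Set.image2 conjMap Y ↑X)
  have hZ : Z.Finite := (hY.image2 _ (Finset.finite_toSet _)).insert 1
  have hZP : ∀ z ∈ Z, z * S ∈ PP := by
    rintro z (rfl | ⟨y, hy, x, hx, rfl⟩)
    · rwa [one_mul]
    · exact (hXC x hx).1 y hy
  have hYZ : ∀ y ∈ Y, ∀ x ∈ X, conjMap y x ∈ Z := fun y hy x hx =>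
    Set.mem_insert_of_mem _ ⟨y, hy, x, hx, rfl⟩
  have hD : ∀ z ∈ Z, ∃ C ∈ F, ∃ T ∈ EE, ∀ c ∈ C, ∀ β ∈ T,
      conjMap (z * S * discDeriv β S) c ∈ PP := fun z hz =>
    hPP.deriv_mem _ (hZP z hz) S hS
  choose! C hCF T hT hCT using hD
  have hU : {u | ((∃ x ∈ X, x * u ∈ returnSet e A) ∧ ∀ x ∈ X, x * u ∈ W) ∧
      ∀ z ∈ Z, conjMap (z * S) u ∈ PP ∧ u ∈ C z} ∈ F := by
    refine (Filter.Eventually.and hX ?_).and ?_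
    · exact (eventually_all_finset _).2 fun x hx => hWcore x (hXC x hx).2
    · exact (eventually_all_finite hZ).2 fun z hz =>
        (hPP.eventually_conjMap (hZP z hz)).and (hCF z hz)
  obtain ⟨U, hUF, hUsub, hUcore⟩ := hF.exists_core hU
  have hE : ∀ᶠ γ in EE, (∀ z ∈ Z, γ ∈ T z) ∧ ∀ Q ∈ QS, ∀ c,
      IsPerturbation H Q (conjMap (Q * discDeriv γ Q) c) := by
    refine ((eventually_all_finite hZ).2 hT).and ((eventually_all_finite hQS).2 fun Q hQ => ?_)
    obtain ⟨N, hN⟩ := hQH Q hQ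
    exact hH.eventually_perturbation hN
  obtain ⟨b, hb⟩ := exists_before_both β hE
  obtain ⟨u₀, hu₀⟩ := nonempty_of_mem hUF
  obtain ⟨α, hα, x, hxX, u, hxA, hQA, hzU⟩ := exists_focused hPP he hH hQS hZ
    (Set.mem_insert _ _) hstep (A := A) hUcore (X := X) (S := S)
    (fun Q hQ x hx => hYZ Q (Set.mem_insert_of_mem _ (Or.inr hQ)) x hx)
    (fun u hu => (hUsub hu).1.1) (fun u hu z hz => ((hUsub hu).2 z hz).1)
    (fun ω hω u hu z hz => hCT z hz u ((hUsub hu).2 z hz).2 ω ((hb ω hω).2.1 z hz))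
    (fun γ hγ => (hb γ hγ).2.2) (X \ ∅).card ∅ le_rfl (fun _ => ∅) ∅ u₀
    (fun h => by simp at h) (by simpa using hu₀) (by simp) (by simp) (by simp) (by simp)
    (by simp) (by simp)
  have hWe : ∀ g ∈ W, ∀ᶠ y in (e : Filter G), g * y ∈ W := fun g hg => he.mem _ (hWcore g hg)
  have hfin : ∀ᶠ y in (e : Filter G), (x * u * y ∈ A ∧
      ∀ Q ∈ QS, x * (conjMap Q x α * u) * y ∈ A) ∧
      ∀ P ∈ R, x * (conjMap (P * S⁻¹) x α * u) * y ∈ W := by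
    refine (Filter.Eventually.and hxA ((eventually_all_finite hQS).2 hQA)).and
      ((eventually_all_finite hR).2 fun P hP => hWe _ ?_)
    exact (hUsub (hzU _ (hYZ _ (Set.mem_insert_of_mem _ (Or.inl ⟨P, hP, rfl⟩)) x hxX))).1.2 x hxX
  obtain ⟨y, ⟨hy1, hy2⟩, hy3⟩ := hfin.exists
  -- The first factor cancels `S(α)`, and `Q(α) x = x Q^x(α)`.
  refine ⟨α, (hb α hα).1, (S α)⁻¹ * (x * u * y), fun P hP => hWV ?_, ?_⟩
  · convert hy3 P hP using 1
    simp only [conjMap, Pi.mul_apply, Pi.inv_apply]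
    group
  · rintro P (rfl | ⟨Q, hQ, rfl⟩)
    · simpa using hy1
    · convert hy2 Q hQ using 1
      simp only [conjMap, Pi.mul_apply]
      group

end Focusing

/-! ### PET induction on leading terms. -/

section PET

variable {G : Type*} [Group G] {F : Filter G} {e : Ultrafilter G} {PP : Set (FinSets → G)}
  {H : ℕ → Subgroup (FinSets → G)}

/-- `Q` is congruent to the leading term `p.2` of level `p.1 + 1`. -/
def HasLeading (H : ℕ → Subgroup (FinSets → G)) (Q : FinSets → G)
    (p : ℕ × (FinSets → G)) : Prop :=
  Q ∈ H (p.1 + 1) ∧ Q * p.2⁻¹ ∈ H p.1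

theorem HasLeading.of_perturbation (hH : IsPETChain H) {Q Q' : FinSets → G}
    {p : ℕ × (FinSets → G)} (h : HasLeading H Q p) (hQ : IsPerturbation H Q Q') :
    HasLeading H Q' p := by
  have h1 := hQ p.1 h.1
  refine ⟨?_, ?_⟩
  · simpa using mul_mem (hH.mono (Nat.le_succ _) h1) h.1
  · simpa [mul_assoc] using mul_mem h1 h.2

theorem HasLeading.snd_mem (hH : IsPETChain H) {Q : FinSets → G}
    {p : ℕ × (FinSets → G)} (h : HasLeading H Q p) : p.2 ∈ H (p.1 + 1) := by
  simpa using mul_mem (inv_mem (hH.mono (Nat.le_succ _) h.2)) h.1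

theorem HasLeading.mul_inv_mem {P Q : FinSets → G} {p : ℕ × (FinSets → G)}
    (hP : HasLeading H P p) (hQ : HasLeading H Q p) : Q * P⁻¹ ∈ H p.1 := by
  simpa [mul_assoc] using mul_mem hQ.2 (inv_mem hP.2)

theorem HasLeading.mul_inv_of_eq (hH : IsPETChain H) {P Q a b : FinSets → G} {n : ℕ}
    (hP : HasLeading H P (n, a)) (hQ : HasLeading H Q (n, b)) :
    HasLeading H (Q * P⁻¹) (n, b * a⁻¹) := by
  refine ⟨mul_mem hQ.1 (inv_mem hP.1), ?_⟩
  have h1 := hH.conj hP.1 (inv_mem hP.2)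
  have h2 := mul_mem hQ.2 (hH.conj (inv_mem (hQ.snd_mem hH)) h1)
  convert h2 using 1
  group

theorem HasLeading.mul_inv_of_lt (hH : IsPETChain H) {P Q a b : FinSets → G} {n m : ℕ}
    (hnm : n < m) (hP : HasLeading H P (n, a)) (hQ : HasLeading H Q (m, b)) :
    HasLeading H (Q * P⁻¹) (m, b) := by
  have hP' : P ∈ H m := hH.mono hnm hP.1
  refine ⟨mul_mem hQ.1 (inv_mem (hH.mono (Nat.le_succ m) hP')), ?_⟩
  have h2 := mul_mem hQ.2 (hH.conj (inv_mem (hQ.snd_mem hH)) (inv_mem hP'))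
  convert h2 using 1
  group

/-- The weight counts leading terms, not maps: focusing may multiply the maps, but perturbations
share their leading term. -/
theorem recurs_of_leading [F.NeBot] (hF : IsIdempotentFilter F) (hPP : IsGoodCollection F PP)
    (he : IsMinimalIdempotent F e) (hH : IsPETChain H) (μ : Multiset ℕ) :
    ∀ (L : Multiset (ℕ × (FinSets → G))), L.map Prod.fst = μ →
    ∀ (S : FinSets → G) (QS : Set (FinSets → G)), QS.Finite → S ∈ PP → (∀ Q ∈ QS, Q * S ∈ PP) →
    (∀ Q ∈ QS, Q ∈ H 0 ∨ ∃ p ∈ L, HasLeading H Q p) →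
    Recurs F e PP (insert S ((· * S) '' QS)) := by
  classical
  induction μ using (wellFounded_lt (α := ℕ)).cutExpand.induction with
  | _ μ ih =>
  intro L hL S QS hQS hS hQP hlead
  let QS₁ : Set (FinSets → G) := {Q ∈ QS | Q ∉ H 0}
  have hlead₁ : ∀ Q ∈ QS₁, ∃ p ∈ L, HasLeading H Q p := fun Q hQ =>
    (hlead Q hQ.1).resolve_left hQ.2
  have hQS₁ : QS₁.Finite := hQS.subset (Set.sep_subset _ _)
  -- Maps in `H 0` are almost everywhere `1`, so they only repeat `S`.
  suffices h : Recurs F e PP (insert S ((· * S) '' QS₁)) by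
    refine h.of_eventuallyEq ((hQS.image _).insert S) ?_
    rintro P (rfl | ⟨Q, hQ, rfl⟩)
    · exact ⟨P, Set.mem_insert _ _, EventuallyEq.rfl⟩
    · by_cases h0 : Q ∈ H 0
      · refine ⟨S, Set.mem_insert _ _, ?_⟩
        filter_upwards [hH.zero.1 h0] with α hα
        simp [hα]
      · exact ⟨Q * S, Set.mem_insert_of_mem _ ⟨Q, ⟨hQ, h0⟩, rfl⟩, EventuallyEq.rfl⟩
  refine recurs_of_perturbations hF hPP he hH hQS₁ hS (fun Q hQ => hQP Q hQ.1)
    (fun Q hQ => ?_) ?_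
  · obtain ⟨p, -, hp⟩ := hlead₁ Q hQ
    exact ⟨_, hp.1⟩
  intro S' QS' hfin hQS'
  have hlead' : ∀ Q ∈ QS', ∃ p ∈ L, HasLeading H Q p := by
    intro Q' hQ'
    obtain ⟨-, Q, hQ, hpert⟩ := hQS' Q' hQ'
    obtain ⟨p, hp, h⟩ := hlead₁ Q hQ
    exact ⟨p, hp, h.of_perturbation hH hpert⟩
  rcases QS'.eq_empty_or_nonempty with rfl | ⟨Q₀, hQ₀⟩
  · simpa using recurs_empty hF hPP
  -- The new base is `P * S'` with `P` of lowest level, so that dividing by `P` leaves higher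
  -- leading terms intact.
  have hex : ∃ n, ∃ P ∈ QS', ∃ a, (n, a) ∈ L ∧ HasLeading H P (n, a) := by
    obtain ⟨⟨n, a⟩, hp, h⟩ := hlead' Q₀ hQ₀
    exact ⟨n, Q₀, hQ₀, a, hp, h⟩
  obtain ⟨P, hP, a, haL, hPa⟩ := Nat.find_spec hex
  have hmin : ∀ Q ∈ QS', ∀ p ∈ L, HasLeading H Q p → Nat.find hex ≤ p.1 := fun Q hQ p hp h =>
    Nat.find_min' hex ⟨Q, hQ, p.2, hp, h⟩
  generalize Nat.find hex = n at hPa haL hmin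
  have hnew : ((· * P⁻¹) '' QS').Finite := hfin.image _
  -- Quotients of maps sharing the leading term of `P` fall into `H n`; for `n > 0` each serves as
  -- its own leading term of level `n - 1`. Listing all quotients is harmless, as only finiteness
  -- matters.
  let extra : Multiset (ℕ × (FinSets → G)) :=
    if n = 0 then 0 else hnew.toFinset.val.map fun Z => (n - 1, Z)
  let shift : ℕ × (FinSets → G) → ℕ × (FinSets → G) := fun q =>
    if q.1 = n then (n, q.2 * a⁻¹) else q
  have hshift : ∀ q, (shift q).1 = q.1 := by
    intro q
    by_cases h : q.1 = n
    · simp only [shift, if_pos h, h]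
    · simp only [shift, if_neg h]
  have key := ih (((L.erase (n, a)).map shift + extra).map Prod.fst) ?_ _ rfl (P * S')
    ((· * P⁻¹) '' QS') hnew (hQS' P hP).1 ?_ ?_
  · refine key.mono ?_
    rintro _ ⟨Q, hQ, rfl⟩
    refine Set.mem_insert_of_mem _ ⟨Q * P⁻¹, ⟨Q, hQ, rfl⟩, ?_⟩
    simp only
    group
  -- One occurrence of `n` is traded for finitely many smaller numbers.
  · refine ⟨extra.map Prod.fst, n, ?_, ?_⟩
    · intro k hk
      by_cases h0 : n = 0
      · simp [extra, h0] at hk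
      · simp only [extra, if_neg h0, Multiset.map_map, Multiset.mem_map] at hk
        obtain ⟨Z, -, rfl⟩ := hk
        simp only [Function.comp]
        omega
    · have h1 : (L.erase (n, a)).map (Prod.fst ∘ shift) + {n} = L.map Prod.fst := by
        conv_rhs => rw [← Multiset.cons_erase haL, Multiset.map_cons, ← Multiset.singleton_add,
          add_comm]
        congr 1
        exact Multiset.map_congr rfl fun q _ => hshift q
      rw [Multiset.map_add, Multiset.map_map, add_right_comm, h1, hL]
  · rintro _ ⟨Q, hQ, rfl⟩
    have := (hQS' Q hQ).1
    simpa [mul_assoc] using this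
  · rintro _ ⟨Q, hQ, rfl⟩
    obtain ⟨⟨m, c⟩, hq, hQc⟩ := hlead' Q hQ
    by_cases heq : (m, c) = (n, a)
    · rw [heq] at hQc
      have hZ := hPa.mul_inv_mem hQc
      rcases Nat.eq_zero_or_pos n with h0 | h0
      · left
        simpa only [h0] using hZ
      · right
        refine ⟨(n - 1, Q * P⁻¹), Multiset.mem_add.2 (Or.inr ?_), ?_, ?_⟩
        · simp only [extra, if_neg h0.ne']
          exact Multiset.mem_map.2 ⟨_, (Set.Finite.mem_toFinset hnew).2 ⟨Q, hQ, rfl⟩, rfl⟩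
        · simpa only [Nat.sub_add_cancel h0] using hZ
        · simp only [mul_inv_cancel]
          exact one_mem _
    · right
      refine ⟨shift (m, c), Multiset.mem_add.2 (Or.inl (Multiset.mem_map_of_mem _
        ((Multiset.mem_erase_of_ne heq).2 hq))), ?_⟩
      rcases (hmin Q hQ _ hq hQc).lt_or_eq with hlt | rfl
      · rw [show shift (m, c) = (m, c) from if_neg hlt.ne']
        exact hPa.mul_inv_of_lt hH hlt hQc
      · rw [show shift (n, c) = (n, c * a⁻¹) from if_pos rfl]
        exact hPa.mul_inv_of_eq hH hQc

theorem recurs_of_subset [F.NeBot] (hF : IsIdempotentFilter F) (hPP : IsGoodCollection F PP)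
    (he : IsMinimalIdempotent F e) (hH : IsPETChain H) {N : ℕ} {S : FinSets → G}
    {QS : Set (FinSets → G)} (hQS : QS.Finite) (hQN : QS ⊆ H N) (hS : S ∈ PP)
    (hQP : ∀ Q ∈ QS, Q * S ∈ PP) : Recurs F e PP (insert S ((· * S) '' QS)) := by
  refine recurs_of_leading hF hPP he hH _ (hQS.toFinset.val.map fun Q => (N, Q)) rfl S QS hQS hS
    hQP fun Q hQ => Or.inr ⟨(N, Q), Multiset.mem_map.2 ⟨Q, hQS.mem_toFinset.2 hQ, rfl⟩,
      hH.mono (Nat.le_succ N) (hQN hQ), ?_⟩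
  simp only [mul_inv_cancel]
  exact one_mem _

end PET

end NilpotentPHJ

/-! ### Reduction of the theorem to recurrence. -/

theorem mainTheorem2 {G : Type*} [Group G] [Group.IsNilpotent G]
    (F : Filter G) [F.NeBot] (hF : IsIdempotentFilter F)
    (PP : Set (FinSets → G)) (hPP : IsGoodCollection F PP)
    (𝒜 𝒜neg 𝒜pos : Set (FinSets → G)) (Pmin : FinSets → G)
    (h𝒜 : IsMinimalSystem PP 𝒜 Pmin) (hpart : IsPartition 𝒜 𝒜neg 𝒜pos) :
    ∀ β : FinSets, ∀ V ∈ F, ∀ A : Set G, IsPiecewiseSyndetic F A →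
      ∃ α : FinSets, β.Before α ∧ ∃ v ∈ V,
        (∀ P ∈ 𝒜neg, P α * v ∈ V) ∧
        (∀ P ∈ {(1 : FinSets → G)} ∪ 𝒜pos, P α * v ∈ A) := by
  rintro β V hV A ⟨p, hp, hA⟩
  obtain ⟨hpF, e, he, hpe⟩ := exists_minimalIdempotent hF hp
  have hone : (1 : FinSets → G) ∈ 𝒜 := by rw [hpart.union_eq]; simp
  have hneg : 𝒜neg ⊆ 𝒜 := fun P hP => by rw [hpart.union_eq]; simp [hP]
  have hpos : 𝒜pos ⊆ 𝒜 := fun P hP => by rw [hpart.union_eq]; simp [hP]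
  have hfin := h𝒜.system.1
  have hposfin := hfin.subset hpos
  have hS : Pmin⁻¹ ∈ PP := by simpa using h𝒜.mul_inv_mem 1 hone
  obtain ⟨W, hW, hWV, hWcore⟩ := hF.exists_core hV
  have hx : ∃ x, {y | x * y ∈ A} ∈ e ∧ x ∈ W ∧ ∀ P ∈ 𝒜, conjMap P x * Pmin⁻¹ ∈ PP := by
    have h1 : {x | {y | x * y ∈ A} ∈ e} ∈ p := by
      rw [← hpe] at hA
      exact mem_mul.1 hA
    have h2 : {x | ∀ P ∈ 𝒜, conjMap P x * Pmin⁻¹ ∈ PP} ∈ F :=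
      (eventually_all_finite hfin).2 fun P hP =>
        hPP.eventually_conjMap_mul hS (h𝒜.mul_inv_mem P hP)
    obtain ⟨x, hx1, hx2⟩ := p.nonempty_of_mem (inter_mem h1 (hpF _ (inter_mem hW h2)))
    exact ⟨x, hx1, hx2⟩
  obtain ⟨x, hxA, hxW, hxP⟩ := hx
  obtain ⟨H, hH, N, hN⟩ := exists_petChain hposfin fun P hP => h𝒜.system.2 P (hpos hP)
  have hrec : Recurs F e PP (insert Pmin⁻¹ ((· * Pmin⁻¹) '' ((conjMap · x) '' 𝒜pos))) := by
    -- Conjugation by `x` is controlled only for maps in a term `H (n + 1)`, hence the shift by one.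
    refine recurs_of_subset hF hPP he hH (N := N + 1) (hposfin.image _) ?_ hS ?_
    · rintro _ ⟨P, hP, rfl⟩
      have h1 : P ∈ H (N + 1) := hH.mono (Nat.le_succ N) (hN hP)
      have h2 := mul_mem (hH.mono (Nat.le_succ N) (hH.perturbation_conj P x N h1)) h1
      simpa using h2
    · rintro _ ⟨P, hP, rfl⟩
      exact hxP P (hpos hP)
  obtain ⟨α, hα, w, h1, h2⟩ := hrec ((fun P => conjMap P x * Pmin⁻¹) '' 𝒜) (hfin.image _)
    (by rintro _ ⟨P, hP, rfl⟩; exact hxP P hP) β {y | x * y ∈ W} (hWcore x hxW) {y | x * y ∈ A} hxA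
  have hmem : ∀ P ∈ 𝒜, P α * (x * ((Pmin α)⁻¹ * w)) ∈ V := by
    intro P hP
    have := hWV (h1 _ ⟨P, hP, rfl⟩)
    convert this using 1
    simp only [conjMap, Pi.mul_apply, Pi.inv_apply]
    group
  refine ⟨α, hα, x * ((Pmin α)⁻¹ * w), by simpa using hmem 1 hone,
    fun P hP => hmem P (hneg hP), ?_⟩
  rintro P (hP | hP)
  · rw [Set.mem_singleton_iff.1 hP]
    simpa using h2 _ (Set.mem_insert _ _)
  · have := h2 _ (Set.mem_insert_of_mem _ ⟨_, ⟨P, hP, rfl⟩, rfl⟩)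
    have h3 : x * ((conjMap P x * Pmin⁻¹) α * w) ∈ A := this
    convert h3 using 1
    simp only [conjMap, Pi.mul_apply, Pi.inv_apply]
    group
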